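/- A signed hypergraph $H=(V,S)$ consists of a finite set $V$ of nodes and a finite set $S$ of pairwise distinct signed edges $s=(e,\eta_s)$, where $e\subseteq V$, $|e|\ge 2$ and $\eta_s:e\to\{-1,+1\}$; we write $v\in s$ for $v\in e$. Its rank $r$ is the maximum of $|e|$ over all signed edges, and its underlying hypergraph is $(V,E)$, where $E$ is the set of all $e$ that occur in a signed edge. The pseudo-Boolean polytope $\mathrm{PBP}(H)\subset\mathbb R^{V\cup S}$ is the convex hull of $$\Big\{z\in\{0,1\}^{V\cup S} : z_s=\prod_{v\in s}\sigma_s(z_v)\ \text{ for all } s\in S\Big\},$$ where $\sigma_s(z_v)=z_v$ if $\eta_s(v)=+1$ and $\sigma_s(z_v)=1-z_v$ if $\eta_s(v)=-1$. For a hypergraph $G=(V,E)$ and $v\in V$ let $G-v$ be the hypergraph with node set $V\setminus\{v\}$ and edge set $\{e\setminus\{v\}: e\in E,\ e\setminus\{v\}\neq\emptyset\}$. A node $v$ is a $\beta$-leaf of $G$ if the edges of $G$ containing $v$ are totally ordered by inclusion, and $G$ is $\beta$-acyclic if its nodes can be ordered $v_1,\dots,v_{|V|}$ so that $v_i$ is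 a $\beta$-leaf of $G-v_1-\cdots-v_{i-1}$ for every $i$. An extended formulation of a set $P\subseteq\mathbb R^{n}$ is a finite system of linear inequalities $Az+By\le b$ in variables $(z,y)\in\mathbb R^{n}\times\mathbb R^{k}$, for some $k\ge 0$, such that $P=\{z : \exists y,\ Az+By\le b\}$. It has $n+k$ variables, and an equation counts as two inequalities. **Theorem.** Let $H=(V,S)$ be a signed hypergraph with $S\neq\emptyset$, of rank $r$, whose underlying hypergraph is $\beta$-acyclic. Then $\mathrm{PBP}(H)$ has an extended formulation with at most $2r(2|S|+1)|V|$ variables and at most $4r(2|S|+1)|V|$ inequalities, in which all coefficients and all right-hand sides are $0$ or $\pm1$. -/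

import Mathlib

/-! ### Hypergraphs: removing nodes, β-leaves, β-acyclicity -/

namespace Hypergraph

variable {α : Type*}

/-- The hypergraph `G - v`: its node set is `V \ {v}`, and its edges are the sets
`e \ {v}` with `e ∈ E` that are nonempty. -/
def removeNode (G : Hypergraph α) (v : α) : Hypergraph α where
  vertexSet := G.vertexSet \ {v}
  edgeSet := {f | f.Nonempty ∧ ∃ e ∈ G.edgeSet, f = e \ {v}}
  subset_vertexSet_of_mem_edgeSet' := by
    rintro f ⟨-, e, he, rfl⟩
    exact Set.sdiff_subset_sdiff_left (G.subset_vertexSet_of_mem_edgeSet' he)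

/-- A node `v` is a β-leaf of `G` if the edges containing `v` are totally ordered by inclusion. -/
def IsBetaLeaf (G : Hypergraph α) (v : α) : Prop :=
  v ∈ G.vertexSet ∧ IsChain (· ⊆ ·) {e | e ∈ G.edgeSet ∧ v ∈ e}

/-- `[v₁, …, vₜ]` is a sequence of β-leaves of `G`: `v₁` is a β-leaf of `G`, `v₂` is a β-leaf of
`G - v₁`, and so on. The nodes are automatically distinct, since `vᵢ` is a node of
`G - v₁ - ⋯ - vᵢ₋₁`. -/
def IsBetaLeafSeq : Hypergraph α → List α → Prop
  | _, [] => True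
  | G, v :: l => G.IsBetaLeaf v ∧ IsBetaLeafSeq (G.removeNode v) l

/-- `G` is β-acyclic if it has a sequence of β-leaves of length `|V|` (for a finite node set). -/
def IsBetaAcyclic (G : Hypergraph α) : Prop :=
  ∃ l : List α, G.IsBetaLeafSeq l ∧ l.length = G.vertexSet.ncard

end Hypergraph

/-! ### Signed hypergraphs and the pseudo-Boolean polytope -/

/-- A signed edge on the node set `V`: a set of at least two nodes with a sign `+1` or `-1`
at each of its nodes. -/
structure SignedEdge (V : Type*) where
  /-- the underlying edge -/
  edge : Finset V
  two_le_card : 2 ≤ edge.card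
  /-- the signs, in `ℤˣ = {1, -1}` -/
  sign : edge → ℤˣ

/-- A signed hypergraph on the node set `V` with no identical signed edges (parallel signed edges
are allowed). -/
structure SignedHypergraph (V : Type*) where
  /-- the set of signed edges -/
  edges : Finset (SignedEdge V)

namespace SignedHypergraph

variable {V : Type*}

/-- The underlying hypergraph: signs are ignored and parallel edges are dropped. -/
def underlying (H : SignedHypergraph V) : Hypergraph V where
  vertexSet := Set.univ
  edgeSet := {f | ∃ s ∈ H.edges, f = (s.edge : Set V)}
  subset_vertexSet_of_mem_edgeSet' := fun _ _ => Set.subset_univ _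

/-- The rank: the maximum cardinality of an edge. -/
def rank (H : SignedHypergraph V) : ℕ :=
  H.edges.sup fun s => s.edge.card

/-- The index set `V ∪ S` of the variables: one variable per node and one per signed edge. -/
abbrev Idx (H : SignedHypergraph V) : Type _ :=
  V ⊕ {s : SignedEdge V // s ∈ H.edges}

/-- `σ_s(z_v)`: it is `z_v` if the sign is `+1`, and `1 - z_v` if the sign is `-1`. -/
noncomputable def literal (ε : ℤˣ) (x : ℝ) : ℝ :=
  if ε = 1 then x else 1 - x

/-- The pseudo-Boolean set: the `0`-`1` points `z` indexed by `V ∪ S` with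
`z_s = ∏_{v ∈ s} σ_s(z_v)` for all `s ∈ S`. -/
def pseudoBooleanSet (H : SignedHypergraph V) : Set (H.Idx → ℝ) :=
  {z | (∀ i, z i = 0 ∨ z i = 1) ∧
    ∀ s : {s : SignedEdge V // s ∈ H.edges},
      z (Sum.inr s) = ∏ v : s.1.edge, literal (s.1.sign v) (z (Sum.inl v.1))}

/-- The pseudo-Boolean polytope: the convex hull of the pseudo-Boolean set. -/
def pseudoBooleanPolytope (H : SignedHypergraph V) : Set (H.Idx → ℝ) :=
  convexHull ℝ H.pseudoBooleanSet

end SignedHypergraph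

/-! ### Extended formulations -/

/-- An extended formulation of `P ⊆ ℝ^ι`: a finite system of linear inequalities
`A z + B y ≤ b` in the variables `z ∈ ℝ^ι` and finitely many additional variables `y`, such that
`P` is the projection of its solution set onto the space of the `z` variables.
An equation has to be written as two inequalities. -/
structure ExtendedFormulation {ι : Type*} [Fintype ι] (P : Set (ι → ℝ)) where
  /-- the number of additional variables -/
  numExtra : ℕ
  /-- the number of inequalities -/
  numIneqs : ℕ
  /-- the coefficients of the original variables -/
  A : Matrix (Fin numIneqs) ι ℝ
  /-- the coefficients of the additional variables -/
  B : Matrix (Fin numIneqs) (Fin numExtra) ℝ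
  /-- the right-hand sides -/
  b : Fin numIneqs → ℝ
  mem_iff : ∀ z : ι → ℝ, z ∈ P ↔
    ∃ y : Fin numExtra → ℝ, ∀ i, A.mulVec z i + B.mulVec y i ≤ b i

namespace ExtendedFormulation

variable {ι : Type*} [Fintype ι] {P : Set (ι → ℝ)}

/-- The total number of variables, original and additional. -/
def numVars (F : ExtendedFormulation P) : ℕ :=
  Fintype.card ι + F.numExtra

/-- All coefficients and all right-hand sides are `0`, `1` or `-1`. -/
def IsZeroPlusMinusOne (F : ExtendedFormulation P) : Prop :=
  (∀ i j, F.A i j ∈ ({0, 1, -1} : Set ℝ)) ∧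
  (∀ i j, F.B i j ∈ ({0, 1, -1} : Set ℝ)) ∧
  ∀ i, F.b i ∈ ({0, 1, -1} : Set ℝ)

end ExtendedFormulation

/-!
The pseudo-Boolean polytope is the set of vectors of expected values `E[a(x)]`, where `x` is a
random Boolean assignment to the nodes and `a` runs through the terms (conjunctions of literals)
of the nodes and signed edges. The nodes are ordered by an elimination sequence of β-leaves. For
a node `v`, let `D v` be the set of tails after `v` of the terms with a literal at `v`. The node
sets of these tails form a chain (`Hypergraph.IsBetaLeafSeq.chain`), and two tails satisfied by
a common assignment agree where both are defined. Hence the subcubes given by `D v` are pairwise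
nested or disjoint (`BooleanTerm.IsNested.isLaminar_tails`), and every assignment that satisfies
a member of `D v` has a finest one.

The extended formulation has a variable `Y a` for the probability of each term `a` that is empty
or of the form `A ∧ (x v = b)` with `A ∈ D v`, and a variable `δ v A b ≥ 0` for the probability
that `A` is the finest satisfied member of `D v` and `x v = b`. Besides normalization, it says
that `Y (A ∧ v) + Y (A ∧ ¬v) = Y A`, and that `Y (B ∧ (x v = b))` is the sum of `δ v A b` over
the `A ∈ D v` that refine `B`. All coefficients are `0` or `±1`, and there is at most one pair
`(v, A)` for each literal of each term, so the size is linear in `|V| + r |S|`.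

A distribution clearly gives a solution (`BooleanTerm.IsNested.isFeasible`). Conversely, a
solution gives a distribution (`BooleanTerm.IsNested.exists_distribution`), built from the last
node of the order to the first: when `v` is reached, the probabilities of all `A ∈ D v` are
already right, thus so are the probabilities `δ v A true + δ v A false` that `A` is the finest
satisfied member. The value of `x v` is then drawn, given that `A` is the finest one, with
probabilities proportional to `δ v A true` and `δ v A false`
(`BooleanTerm.IsLaminar.exists_resample`).
-/

/-! ### Terms and assignments -/

namespace BooleanTerm

variable {V : Type*}

/-- The value of a term at a Boolean assignment. A term is a conjunction of literals, encoded as the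
finite set of the pairs `(v, b)` that stand for the literals `x v = b`. -/
def value (c : Finset (V × Bool)) (x : V → Bool) : ℝ :=
  ∏ p ∈ c, if x p.1 = p.2 then 1 else 0

/-- The assignment `x` satisfies the term `c`. -/
def Sat (x : V → Bool) (c : Finset (V × Bool)) : Prop :=
  ∀ p ∈ c, x p.1 = p.2

theorem value_of_sat {c : Finset (V × Bool)} {x : V → Bool} (h : Sat x c) : value c x = 1 :=
  Finset.prod_eq_one fun p hp => if_pos (h p hp)

theorem value_of_not_sat {c : Finset (V × Bool)} {x : V → Bool} (h : ¬ Sat x c) :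
    value c x = 0 := by
  simp only [Sat, not_forall] at h
  obtain ⟨p, hp, hne⟩ := h
  exact Finset.prod_eq_zero hp (if_neg hne)

@[simp] theorem value_empty (x : V → Bool) : value ∅ x = 1 := by simp [value]

theorem value_insert [DecidableEq V] {c : Finset (V × Bool)} {v : V} (hv : ∀ p ∈ c, p.1 ≠ v)
    (b : Bool) (x : V → Bool) :
    value (insert (v, b) c) x = (if x v = b then 1 else 0) * value c x := by
  rw [value, Finset.prod_insert fun h => hv _ h rfl, value]

theorem value_update [DecidableEq V] {c : Finset (V × Bool)} {v : V} (hv : ∀ p ∈ c, p.1 ≠ v)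
    (b : Bool) (x : V → Bool) : value c (Function.update x v b) = value c x :=
  Finset.prod_congr rfl fun p hp => by rw [Function.update_of_ne (hv p hp)]

/-- Two terms satisfied by the same assignment are ordered as their sets of nodes. -/
theorem Sat.subset {x : V → Bool} {c d : Finset (V × Bool)} (hc : Sat x c) (hd : Sat x d)
    (h : ∀ p ∈ c, ∃ b, (p.1, b) ∈ d) : c ⊆ d := by
  intro p hp
  obtain ⟨b, hb⟩ := h p hp
  have h1 := hd _ hb
  have h2 := hc _ hp
  rwa [show b = p.2 from h1.symm.trans h2] at hb

/-! ### Laminar families of terms -/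

/-- A finite family of terms is laminar if any two terms that are satisfied by a common assignment
are comparable; then the subcubes that the terms define are pairwise disjoint or nested. -/
def IsLaminar (D : Finset (Finset (V × Bool))) : Prop :=
  ∀ x, ∀ A ∈ D, ∀ B ∈ D, Sat x A → Sat x B → A ⊆ B ∨ B ⊆ A

/-- Among the terms of `D` that `x` satisfies, `A` is the one that contains all the others, that is,
the one with the smallest subcube. -/
def IsFinest (D : Finset (Finset (V × Bool))) (x : V → Bool) (A : Finset (V × Bool)) : Prop :=
  A ∈ D ∧ Sat x A ∧ ∀ B ∈ D, Sat x B → B ⊆ A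

theorem IsFinest.eq {D : Finset (Finset (V × Bool))} {x : V → Bool} {A B : Finset (V × Bool)}
    (hA : IsFinest D x A) (hB : IsFinest D x B) : A = B :=
  (hB.2.2 A hA.1 hA.2.1).antisymm (hA.2.2 B hB.1 hB.2.1)

theorem IsLaminar.exists_isFinest {D : Finset (Finset (V × Bool))} (hD : IsLaminar D)
    {x : V → Bool} {B : Finset (V × Bool)} (hB : B ∈ D) (hx : Sat x B) :
    ∃ A, IsFinest D x A := by
  classical
  obtain ⟨A, hA, hmax⟩ := (D.filter (Sat x)).exists_max_image Finset.card
    ⟨B, Finset.mem_filter.2 ⟨hB, hx⟩⟩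
  rw [Finset.mem_filter] at hA
  refine ⟨A, hA.1, hA.2, fun C hC hxC => ?_⟩
  rcases hD x A hA.1 C hC hA.2 hxC with h | h
  · exact (Finset.eq_of_subset_of_card_le h (hmax C (Finset.mem_filter.2 ⟨hC, hxC⟩))).ge
  · exact h

open Classical in
/-- The indicator of the assignments whose finest term in `D` is `A`. -/
noncomputable def finestValue (D : Finset (Finset (V × Bool))) (A : Finset (V × Bool))
    (x : V → Bool) : ℝ :=
  if IsFinest D x A then 1 else 0

theorem finestValue_nonneg (D : Finset (Finset (V × Bool))) (A : Finset (V × Bool))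
    (x : V → Bool) : 0 ≤ finestValue D A x := by
  unfold finestValue; split_ifs <;> norm_num

/-- In a laminar family, the subcube of `B` is partitioned according to the finest satisfied
term. -/
theorem IsLaminar.value_eq_sum [DecidableEq V] {D : Finset (Finset (V × Bool))} (hD : IsLaminar D)
    {B : Finset (V × Bool)} (hB : B ∈ D) (x : V → Bool) :
    value B x = ∑ A ∈ D with B ⊆ A, finestValue D A x := by
  by_cases hx : Sat x B
  · obtain ⟨A, hA⟩ := hD.exists_isFinest hB hx
    rw [value_of_sat hx, Finset.sum_eq_single A]
    · exact (if_pos hA).symm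
    · exact fun C _ hCA => if_neg fun hC => hCA (hC.eq hA)
    · exact fun h => absurd (Finset.mem_filter.2 ⟨hA.1, hA.2.2 B hB hx⟩) h
  · rw [value_of_not_sat hx]
    refine (Finset.sum_eq_zero fun A hA => if_neg fun h => hx ?_).symm
    exact fun p hp => h.2.1 p ((Finset.mem_filter.1 hA).2 hp)

/-- Sums over up-sets determine a function on a finite family of finite sets. -/
theorem eq_of_sum_superset_eq {α : Type*} [DecidableEq α] (D : Finset (Finset α))
    (f g : Finset α → ℝ)
    (h : ∀ B ∈ D, ∑ A ∈ D with B ⊆ A, f A = ∑ A ∈ D with B ⊆ A, g A) :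
    ∀ B ∈ D, f B = g B := by
  -- Induction on the number of members of `D` above `B`.
  suffices H : ∀ n, ∀ B ∈ D, (D.filter (B ⊆ ·)).card = n → f B = g B from
    fun B hB => H _ B hB rfl
  intro n
  induction n using Nat.strong_induction_on with
  | _ n ih =>
    intro B hB hn
    have hmem : B ∈ D.filter (B ⊆ ·) := Finset.mem_filter.2 ⟨hB, subset_rfl⟩
    have hs := h B hB
    rw [← Finset.add_sum_erase _ f hmem, ← Finset.add_sum_erase _ g hmem] at hs
    have hrest : ∑ A ∈ (D.filter (B ⊆ ·)).erase B, f A =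
        ∑ A ∈ (D.filter (B ⊆ ·)).erase B, g A := by
      refine Finset.sum_congr rfl fun A hA => ?_
      rw [Finset.mem_erase, Finset.mem_filter] at hA
      refine ih _ ?_ A hA.2.1 rfl
      rw [← hn]
      refine Finset.card_lt_card (Finset.ssubset_iff_of_subset ?_ |>.2 ⟨B, hmem, ?_⟩)
      · exact fun C hC => Finset.mem_filter.2 ⟨(Finset.mem_filter.1 hC).1,
          hA.2.2.trans (Finset.mem_filter.1 hC).2⟩
      · exact fun hC => hA.1 ((Finset.mem_filter.1 hC).2.antisymm hA.2.2)
    linarith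

/-! ### Redrawing one coordinate of a distribution -/

/-- Splitting a distribution along a coordinate: the coordinate `v` is redrawn, conditionally on
the finest satisfied term, so that the term `A` together with the literal `v = b` receives the mass
prescribed by `δ`. -/
theorem IsLaminar.exists_resample [DecidableEq V] [Fintype V] {D : Finset (Finset (V × Bool))}
    (hD : IsLaminar D) {v : V} (hv : ∀ A ∈ D, ∀ p ∈ A, p.1 ≠ v) {w : (V → Bool) → ℝ}
    (hw : w ∈ stdSimplex ℝ (V → Bool)) {δ : Finset (V × Bool) → Bool → ℝ}
    (hδ : ∀ A ∈ D, ∀ b, 0 ≤ δ A b)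
    (hsum : ∀ B ∈ D, ∑ A ∈ D with B ⊆ A, (δ A true + δ A false) = ∑ x, w x * value B x) :
    ∃ w' ∈ stdSimplex ℝ (V → Bool),
      (∀ c, (∀ p ∈ c, p.1 ≠ v) → ∑ x, w' x * value c x = ∑ x, w x * value c x) ∧
      ∀ B ∈ D, ∀ b, ∑ x, w' x * value (insert (v, b) B) x = ∑ A ∈ D with B ⊆ A, δ A b := by
  classical
  have hmass : ∀ A ∈ D, ∑ x, w x * finestValue D A x = δ A true + δ A false := by
    refine eq_of_sum_superset_eq D (fun A => ∑ x, w x * finestValue D A x) _ fun B hB => ?_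
    rw [hsum B hB, Finset.sum_comm]
    exact Finset.sum_congr rfl fun x _ => by rw [hD.value_eq_sum hB, Finset.mul_sum]
  -- The conditional probabilities; where the condition has mass zero they are arbitrary.
  let r : Finset (V × Bool) → Bool → ℝ := fun A b =>
    if δ A true + δ A false = 0 then 1 / 2 else δ A b / (δ A true + δ A false)
  have hr0 : ∀ A ∈ D, ∀ b, 0 ≤ r A b := by
    intro A hA b
    simp only [r]
    split_ifs
    · norm_num
    · exact div_nonneg (hδ A hA b) (add_nonneg (hδ A hA _) (hδ A hA _))
  have hr1 : ∀ A, r A true + r A false = 1 := by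
    intro A
    simp only [r]
    split_ifs with h
    · norm_num
    · rw [← add_div, div_self h]
  have hrδ : ∀ A ∈ D, ∀ b, (δ A true + δ A false) * r A b = δ A b := by
    intro A hA b
    simp only [r]
    split_ifs with h
    · have h1 := hδ A hA true
      have h2 := hδ A hA false
      cases b <;> linarith
    · exact mul_div_cancel₀ _ h
  let k : (V → Bool) → Bool → ℝ := fun x b =>
    if h : ∃ A, IsFinest D x A then r h.choose b else 1 / 2
  have hk0 : ∀ x b, 0 ≤ k x b := by
    intro x b
    simp only [k]
    split_ifs with h
    · exact hr0 _ h.choose_spec.1 b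
    · norm_num
  have hk1 : ∀ x, k x true + k x false = 1 := by
    intro x
    simp only [k]
    split_ifs with h
    · exact hr1 _
    · norm_num
  have hkr : ∀ A x b, k x b * finestValue D A x = r A b * finestValue D A x := by
    intro A x b
    unfold finestValue
    split_ifs with h
    · have h' : ∃ A, IsFinest D x A := ⟨A, h⟩
      simp only [k, dif_pos h', h'.choose_spec.eq h]
    · simp
  let w' : (V → Bool) → ℝ := fun x =>
    ∑ y, ∑ b, if Function.update y v b = x then w y * k y b else 0
  have hexp : ∀ f : (V → Bool) → ℝ, ∑ x, w' x * f x =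
      ∑ y, (w y * k y true * f (Function.update y v true) +
        w y * k y false * f (Function.update y v false)) := by
    intro f
    simp only [w', Finset.sum_mul]
    rw [Finset.sum_comm]
    refine Finset.sum_congr rfl fun y _ => ?_
    rw [Finset.sum_comm, Fintype.sum_bool]
    simp [ite_mul]
  refine ⟨w', ⟨fun x => ?_, ?_⟩, fun c hc => ?_, fun B hB b => ?_⟩
  · refine Finset.sum_nonneg fun y _ => Finset.sum_nonneg fun b _ => ?_
    split_ifs
    · exact mul_nonneg (hw.1 y) (hk0 y b)
    · exact le_rfl
  · have h := hexp fun _ => 1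
    simp only [mul_one] at h
    rw [h, ← hw.2]
    exact Finset.sum_congr rfl fun y _ => by rw [← mul_add, hk1, mul_one]
  · rw [hexp]
    refine Finset.sum_congr rfl fun y _ => ?_
    rw [value_update hc, value_update hc, ← add_mul, ← mul_add, hk1, mul_one]
  · have h1 : ∑ x, w' x * value (insert (v, b) B) x = ∑ y, w y * k y b * value B y := by
      rw [hexp]
      refine Finset.sum_congr rfl fun y _ => ?_
      rw [value_insert (hv B hB), value_insert (hv B hB), value_update (hv B hB),
        value_update (hv B hB)]
      cases b <;> simp
    rw [h1]
    calc ∑ y, w y * k y b * value B y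
        = ∑ y, ∑ A ∈ D with B ⊆ A, r A b * (w y * finestValue D A y) := by
          refine Finset.sum_congr rfl fun y _ => ?_
          rw [hD.value_eq_sum hB, Finset.mul_sum]
          refine Finset.sum_congr rfl fun A _ => ?_
          rw [mul_assoc, hkr]
          ring
      _ = ∑ A ∈ D with B ⊆ A, r A b * (δ A true + δ A false) := by
          rw [Finset.sum_comm]
          refine Finset.sum_congr rfl fun A hA => ?_
          rw [← Finset.mul_sum, hmass A (Finset.mem_filter.1 hA).1]
      _ = ∑ A ∈ D with B ⊆ A, δ A b :=
          Finset.sum_congr rfl fun A hA => by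
            rw [mul_comm, hrδ A (Finset.mem_filter.1 hA).1]

end BooleanTerm

/-! ### Nested families of terms -/

namespace BooleanTerm

variable {V : Type*}

section System

variable [LinearOrder V] {ι : Type*} [Fintype ι]

/-- The literals of a term at the nodes after `v`. -/
def tail (v : V) (a : Finset (V × Bool)) : Finset (V × Bool) :=
  a.filter fun p => v < p.1

/-- The tails after `v` of the terms that have a literal at `v`. -/
def tails (c : ι → Finset (V × Bool)) (v : V) : Finset (Finset (V × Bool)) :=
  (Finset.univ.filter fun i => ∃ b, (v, b) ∈ c i).image fun i => tail v (c i)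

/-- The terms that get a variable in the extended formulation: the empty term, and each tail after
`v` together with either literal at `v`. -/
def closure [Fintype V] (c : ι → Finset (V × Bool)) : Finset (Finset (V × Bool)) :=
  insert ∅ (Finset.univ.biUnion fun v =>
    (tails c v ×ˢ Finset.univ).image fun q => insert (v, q.2) q.1)

/-- A family of terms is nested along the order of the nodes: each term has at most one literal at
each node, and the tails after `v` of the terms with a literal at `v` have node sets that form a
chain. -/
structure IsNested (c : ι → Finset (V × Bool)) : Prop where
  injOn : ∀ i, Set.InjOn Prod.fst (c i : Set (V × Bool))
  chain : ∀ v i j, (∃ b, (v, b) ∈ c i) → (∃ b, (v, b) ∈ c j) →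
    (∀ p ∈ c i, v < p.1 → ∃ b, (p.1, b) ∈ c j) ∨ (∀ p ∈ c j, v < p.1 → ∃ b, (p.1, b) ∈ c i)

theorem lt_of_mem_tails {c : ι → Finset (V × Bool)} {v : V} {A : Finset (V × Bool)}
    (hA : A ∈ tails c v) {p : V × Bool} (hp : p ∈ A) : v < p.1 := by
  obtain ⟨i, -, rfl⟩ := Finset.mem_image.1 hA
  exact (Finset.mem_filter.1 hp).2

theorem ne_of_mem_tails {c : ι → Finset (V × Bool)} {v : V} {A : Finset (V × Bool)}
    (hA : A ∈ tails c v) : ∀ p ∈ A, p.1 ≠ v :=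
  fun _ hp => (lt_of_mem_tails hA hp).ne'

theorem empty_mem_closure [Fintype V] (c : ι → Finset (V × Bool)) : ∅ ∈ closure c :=
  Finset.mem_insert_self _ _

theorem insert_mem_closure [Fintype V] {c : ι → Finset (V × Bool)} {v : V} {A : Finset (V × Bool)}
    (hA : A ∈ tails c v) (b : Bool) : insert (v, b) A ∈ closure c := by
  refine Finset.mem_insert_of_mem (Finset.mem_biUnion.2 ⟨v, Finset.mem_univ v, ?_⟩)
  exact Finset.mem_image.2 ⟨(A, b), Finset.mem_product.2 ⟨hA, Finset.mem_univ b⟩, rfl⟩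

theorem mem_closure [Fintype V] {c : ι → Finset (V × Bool)} {a : Finset (V × Bool)} :
    a ∈ closure c ↔ a = ∅ ∨ ∃ v, ∃ A ∈ tails c v, ∃ b, a = insert (v, b) A := by
  constructor
  · intro h
    rcases Finset.mem_insert.1 h with rfl | h
    · exact Or.inl rfl
    · obtain ⟨v, -, h⟩ := Finset.mem_biUnion.1 h
      obtain ⟨q, hq, rfl⟩ := Finset.mem_image.1 h
      exact Or.inr ⟨v, q.1, (Finset.mem_product.1 hq).1, q.2, rfl⟩
  · rintro (rfl | ⟨v, A, hA, b, rfl⟩)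
    · exact empty_mem_closure c
    · exact insert_mem_closure hA b

/-- Every final segment of a term of the family gets a variable. -/
theorem IsNested.filter_mem_closure [Fintype V] {c : ι → Finset (V × Bool)} (hc : IsNested c)
    (i : ι) {a : Finset (V × Bool)} (ha : a ⊆ c i) (hup : ∀ p ∈ a, ∀ q ∈ c i, p.1 < q.1 → q ∈ a) :
    a ∈ closure c := by
  rw [mem_closure]
  rcases a.eq_empty_or_nonempty with h | h
  · exact Or.inl h
  · obtain ⟨p, hp, hmin⟩ := a.exists_min_image Prod.fst h
    refine Or.inr ⟨p.1, tail p.1 (c i), Finset.mem_image.2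
      ⟨i, Finset.mem_filter.2 ⟨Finset.mem_univ i, p.2, ha hp⟩, rfl⟩, p.2, ?_⟩
    ext q
    simp only [Finset.mem_insert, tail, Finset.mem_filter]
    constructor
    · intro hq
      rcases (hmin q hq).eq_or_lt with h1 | h1
      · exact Or.inl (hc.injOn i (ha hp) (ha hq) h1).symm
      · exact Or.inr ⟨ha hq, h1⟩
    · rintro (rfl | ⟨hq, hlt⟩)
      · exact hp
      · exact hup p hp q hq hlt

theorem IsNested.mem_closure_self [Fintype V] {c : ι → Finset (V × Bool)} (hc : IsNested c)
    (i : ι) : c i ∈ closure c :=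
  hc.filter_mem_closure i subset_rfl fun _ _ _ hq _ => hq

theorem IsNested.tails_subset_closure [Fintype V] {c : ι → Finset (V × Bool)} (hc : IsNested c)
    {v : V} {A : Finset (V × Bool)} (hA : A ∈ tails c v) : A ∈ closure c := by
  obtain ⟨i, -, rfl⟩ := Finset.mem_image.1 hA
  refine hc.filter_mem_closure i (Finset.filter_subset _ _) fun p hp q hq hpq => ?_
  exact Finset.mem_filter.2 ⟨hq, (Finset.mem_filter.1 hp).2.trans hpq⟩

/-- The point where β-acyclicity enters: if the node sets of the tails after `v` form a chain, then
the subcubes that the tails define are nested or disjoint, since two tails that share an assignment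
agree on their common nodes. -/
theorem IsNested.isLaminar_tails {c : ι → Finset (V × Bool)} (hc : IsNested c) (v : V) :
    IsLaminar (tails c v) := by
  intro x A hA B hB hxA hxB
  obtain ⟨i, hi, rfl⟩ := Finset.mem_image.1 hA
  obtain ⟨j, hj, rfl⟩ := Finset.mem_image.1 hB
  have key : ∀ i j, (∀ p ∈ c i, v < p.1 → ∃ b, (p.1, b) ∈ c j) →
      ∀ p ∈ tail v (c i), ∃ b, (p.1, b) ∈ tail v (c j) := by
    intro i j h p hp
    have hp' := Finset.mem_filter.1 hp
    obtain ⟨b, hb⟩ := h p hp'.1 hp'.2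
    exact ⟨b, Finset.mem_filter.2 ⟨hb, hp'.2⟩⟩
  rcases hc.chain v i j (Finset.mem_filter.1 hi).2 (Finset.mem_filter.1 hj).2 with h | h
  · exact Or.inl (hxA.subset hxB (key i j h))
  · exact Or.inr (hxB.subset hxA (key j i h))

/-! ### The linear system -/

/-- The linear system of the extended formulation. The variable `Y a` stands for the probability
of the term `a`, and `δ v A b` for the probability that `A` is the finest satisfied tail after `v`
and the node `v` has the value `b`. -/
structure IsFeasible (c : ι → Finset (V × Bool)) (z : ι → ℝ) (Y : Finset (V × Bool) → ℝ)
    (δ : V → Finset (V × Bool) → Bool → ℝ) : Prop where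
  coord : ∀ i, z i = Y (c i)
  empty : Y ∅ = 1
  marginal : ∀ v, ∀ A ∈ tails c v, Y (insert (v, true) A) + Y (insert (v, false) A) = Y A
  decomp : ∀ v, ∀ B ∈ tails c v, ∀ b,
    Y (insert (v, b) B) = ∑ A ∈ tails c v with B ⊆ A, δ v A b
  nonneg : ∀ v, ∀ A ∈ tails c v, ∀ b, 0 ≤ δ v A b

/-- A distribution on the assignments satisfies the system. -/
theorem IsNested.isFeasible [Fintype V] {c : ι → Finset (V × Bool)} (hc : IsNested c)
    {w : (V → Bool) → ℝ} (hw : w ∈ stdSimplex ℝ (V → Bool)) :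
    IsFeasible c (fun i => ∑ x, w x * value (c i) x) (fun a => ∑ x, w x * value a x)
      (fun v A b => ∑ x, w x * ((if x v = b then 1 else 0) * finestValue (tails c v) A x)) where
  coord _ := rfl
  empty := by simpa using hw.2
  marginal v A hA := by
    rw [← Finset.sum_add_distrib]
    refine Finset.sum_congr rfl fun x _ => ?_
    rw [value_insert (ne_of_mem_tails hA), value_insert (ne_of_mem_tails hA)]
    cases x v <;> simp
  decomp v B hB b := by
    rw [Finset.sum_comm]
    refine Finset.sum_congr rfl fun x _ => ?_
    rw [value_insert (ne_of_mem_tails hB), (hc.isLaminar_tails v).value_eq_sum hB, Finset.mul_sum,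
      Finset.mul_sum]
  nonneg v A _ b := by
    refine Finset.sum_nonneg fun x _ => mul_nonneg (hw.1 x) (mul_nonneg ?_ (finestValue_nonneg ..))
    split_ifs <;> norm_num

/-- Every solution of the system comes from a distribution on the assignments. The distribution is
built node by node, from the last node of the order to the first. -/
theorem IsNested.exists_distribution [Fintype V] {c : ι → Finset (V × Bool)} (hc : IsNested c)
    {z : ι → ℝ} {Y : Finset (V × Bool) → ℝ} {δ : V → Finset (V × Bool) → Bool → ℝ}
    (h : IsFeasible c z Y δ) :
    ∃ w ∈ stdSimplex ℝ (V → Bool), ∀ i, z i = ∑ x, w x * value (c i) x := by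
  have key : ∀ U : Finset V, IsUpperSet (U : Set V) → ∃ w ∈ stdSimplex ℝ (V → Bool),
      ∀ a ∈ closure c, (∀ p ∈ a, p.1 ∈ U) → Y a = ∑ x, w x * value a x := by
    intro U
    induction U using Finset.induction_on_min with
    | empty =>
      refine fun _ => ⟨Pi.single (fun _ => false) 1, single_mem_stdSimplex _ _, fun a _ ha => ?_⟩
      have : a = ∅ := Finset.eq_empty_of_forall_notMem fun p hp => by simpa using ha p hp
      subst this
      simpa [Finset.sum_pi_single] using h.empty
    | insert v U hlt ih =>
      intro hU
      have hmem : ∀ u, v < u → u ∈ U := fun u hu =>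
        (Finset.mem_insert.1 (hU hu.le (Finset.mem_insert_self v U))).resolve_left hu.ne'
      obtain ⟨w, hw, hwY⟩ := ih fun x y hxy hx => hmem y ((hlt x hx).trans_le hxy)
      have htail : ∀ B ∈ tails c v,
          ∑ A ∈ tails c v with B ⊆ A, (δ v A true + δ v A false) = ∑ x, w x * value B x := by
        intro B hB
        rw [Finset.sum_add_distrib, ← h.decomp v B hB, ← h.decomp v B hB, h.marginal v B hB]
        exact hwY B (hc.tails_subset_closure hB) fun p hp => hmem _ (lt_of_mem_tails hB hp)
      obtain ⟨w', hw', hold, hnew⟩ := (hc.isLaminar_tails v).exists_resample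
        (fun A hA => ne_of_mem_tails hA) hw (h.nonneg v) htail
      refine ⟨w', hw', fun a ha haU => ?_⟩
      by_cases hav : ∃ p ∈ a, p.1 = v
      · obtain ⟨p, hp, hpv⟩ := hav
        rcases mem_closure.1 ha with rfl | ⟨u, A, hA, b, rfl⟩
        · simp at hp
        · -- `u` is the first node of the term, and no node of the term comes before `v`.
          have huv : u = v := by
            rcases Finset.mem_insert.1 hp with rfl | hpA
            · exact hpv
            · have h1 : u < v := hpv ▸ lt_of_mem_tails hA hpA
              rcases Finset.mem_insert.1 (haU _ (Finset.mem_insert_self _ _)) with h2 | h2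
              · exact h2
              · exact absurd (hlt u h2) h1.not_gt
          subst huv
          rw [hnew A hA, h.decomp u A hA]
      · push Not at hav
        rw [hold a hav]
        exact hwY a ha fun p hp => (Finset.mem_insert.1 (haU p hp)).resolve_left (hav p hp)
  obtain ⟨w, hw, hwY⟩ := key Finset.univ fun _ _ _ _ => by simp
  exact ⟨w, hw, fun i => (h.coord i).trans
    (hwY _ (hc.mem_closure_self i) fun p _ => Finset.mem_univ _)⟩

end System

end BooleanTerm

/-! ### Building extended formulations -/

namespace ExtendedFormulation

variable {ι κ : Type*} [Fintype ι] [Fintype κ]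

/-- An extended formulation from inequalities each of which compares two sums of variables, up to
a constant `0` or `±1`. -/
theorem exists_of_sum_le {J : Type*} [Fintype J] {P : Set (ι → ℝ)} (N M : J → Finset (ι ⊕ κ))
    (b : J → ℝ) (hb : ∀ j, b j ∈ ({0, 1, -1} : Set ℝ))
    (hP : ∀ z, z ∈ P ↔ ∃ y : κ → ℝ, ∀ j,
      ∑ u ∈ N j, Sum.elim z y u ≤ ∑ u ∈ M j, Sum.elim z y u + b j) :
    ∃ F : ExtendedFormulation P, F.numVars = Fintype.card ι + Fintype.card κ ∧
      F.numIneqs = Fintype.card J ∧ F.IsZeroPlusMinusOne := by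
  classical
  let a : J → ι ⊕ κ → ℝ := fun j u => (if u ∈ N j then 1 else 0) - (if u ∈ M j then 1 else 0)
  have ha : ∀ j u, a j u ∈ ({0, 1, -1} : Set ℝ) := by
    intro j u
    simp only [a]
    split_ifs <;> norm_num
  have hsum : ∀ j (z : ι → ℝ) (y : κ → ℝ), ∑ i, a j (Sum.inl i) * z i + ∑ k, a j (Sum.inr k) * y k =
      ∑ u ∈ N j, Sum.elim z y u - ∑ u ∈ M j, Sum.elim z y u := by
    intro j z y
    have : ∑ u, a j u * Sum.elim z y u =
        ∑ u ∈ N j, Sum.elim z y u - ∑ u ∈ M j, Sum.elim z y u := by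
      simp only [a, sub_mul, Finset.sum_sub_distrib, ite_mul, one_mul, zero_mul,
        Finset.sum_ite_mem, Finset.univ_inter]
    rw [← this, Fintype.sum_sum_type]
    rfl
  let eκ := Fintype.equivFin κ
  let eJ := Fintype.equivFin J
  refine ⟨{ numExtra := Fintype.card κ
            numIneqs := Fintype.card J
            A := fun j i => a (eJ.symm j) (Sum.inl i)
            B := fun j k => a (eJ.symm j) (Sum.inr (eκ.symm k))
            b := fun j => b (eJ.symm j)
            mem_iff := fun z => ?_ }, rfl, rfl, fun _ _ => ha _ _, fun _ _ => ha _ _, fun _ => hb _⟩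
  have hB : ∀ (y : Fin (Fintype.card κ) → ℝ) j,
      ∑ k, a j (Sum.inr (eκ.symm k)) * y k = ∑ k, a j (Sum.inr k) * y (eκ k) := fun y j =>
    Fintype.sum_equiv eκ.symm _ _ fun k => by simp
  rw [hP]
  simp only [Matrix.mulVec, dotProduct, hB, hsum]
  constructor
  · rintro ⟨y, hy⟩
    refine ⟨fun k => y (eκ.symm k), fun j => ?_⟩
    have := hy (eJ.symm j)
    have h1 := hsum (eJ.symm j) z y
    simp only [Equiv.symm_apply_apply]
    linarith
  · rintro ⟨y, hy⟩
    refine ⟨fun k => y (eκ k), fun j => ?_⟩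
    have h1 := hsum j z fun k => y (eκ k)
    have := hy (eJ j)
    simp only [Equiv.symm_apply_apply] at this
    linarith

/-- An extended formulation from equations between sums of variables and nonnegativity
constraints. -/
theorem exists_of_sum_eq {E K : Type*} [Fintype E] [Fintype K] {P : Set (ι → ℝ)}
    (N M : E → Finset (ι ⊕ κ)) (b : E → ℝ) (hb : ∀ e, b e = 0 ∨ b e = 1) (f : K → κ)
    (hP : ∀ z, z ∈ P ↔ ∃ y : κ → ℝ,
      (∀ e, ∑ u ∈ N e, Sum.elim z y u = ∑ u ∈ M e, Sum.elim z y u + b e) ∧ ∀ k, 0 ≤ y (f k)) :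
    ∃ F : ExtendedFormulation P, F.numVars = Fintype.card ι + Fintype.card κ ∧
      F.numIneqs = 2 * Fintype.card E + Fintype.card K ∧ F.IsZeroPlusMinusOne := by
  obtain ⟨F, h1, h2, h3⟩ := exists_of_sum_le (P := P)
    (Sum.elim N (Sum.elim M fun _ => ∅)) (Sum.elim M (Sum.elim N fun k => {Sum.inr (f k)}))
    (Sum.elim b (Sum.elim (fun e => -b e) fun _ => 0))
    (by
      rintro (e | e | k)
      · rcases hb e with h | h <;> simp [h]
      · rcases hb e with h | h <;> simp [h]
      · simp)
    (fun z => by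
      rw [hP]
      refine exists_congr fun y => ?_
      simp only [Sum.forall, Sum.elim_inl, Sum.elim_inr, Finset.sum_empty, Finset.sum_singleton,
        add_zero]
      rw [← and_assoc]
      refine and_congr ⟨fun h => ⟨fun e => (h e).le, fun e => by rw [h e]; linarith⟩,
        fun h e => ?_⟩ Iff.rfl
      have := h.1 e
      have := h.2 e
      linarith)
  refine ⟨F, h1, ?_, h3⟩
  rw [h2, Fintype.card_sum, Fintype.card_sum]
  ring

end ExtendedFormulation

namespace BooleanTerm

variable {V : Type*} [Fintype V] [LinearOrder V] {ι : Type*} [Fintype ι]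

/-- A literal of a term contributes to at most one tail: the one after its own node. -/
theorem sum_card_tails_le (c : ι → Finset (V × Bool)) :
    ∑ v, (tails c v).card ≤ ∑ i, (c i).card := by
  calc ∑ v, (tails c v).card
      ≤ ∑ v, (Finset.univ.filter fun i => ∃ b, (v, b) ∈ c i).card :=
        Finset.sum_le_sum fun v _ => Finset.card_image_le
    _ = ∑ i, (Finset.univ.filter fun v => ∃ b, (v, b) ∈ c i).card := by
        simp only [Finset.card_filter]
        exact Finset.sum_comm
    _ ≤ ∑ i, (c i).card := by
        refine Finset.sum_le_sum fun i _ => ?_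
        refine le_trans (Finset.card_le_card fun v hv => ?_)
          (Finset.card_image_le (s := c i) (f := Prod.fst))
        obtain ⟨b, hb⟩ := (Finset.mem_filter.1 hv).2
        exact Finset.mem_image.2 ⟨_, hb, rfl⟩

theorem card_closure_le (c : ι → Finset (V × Bool)) :
    (closure c).card ≤ 1 + 2 * ∑ v, (tails c v).card := by
  refine (Finset.card_insert_le _ _).trans ?_
  rw [add_comm, Finset.mul_sum]
  refine Nat.add_le_add_left (Finset.card_biUnion_le.trans (Finset.sum_le_sum fun v _ => ?_)) 1
  refine Finset.card_image_le.trans ?_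
  rw [Finset.card_product, Finset.card_univ, Fintype.card_bool, mul_comm]

/-! ### The system as an extended formulation -/

/-- The indices of the pairs of a node `v` and a tail after `v`. -/
abbrev TailIdx (c : ι → Finset (V × Bool)) : Type _ :=
  Σ v, {A // A ∈ tails c v}

/-- The indices of the additional variables `Y a` and `δ v A b`. -/
abbrev ExtraIdx (c : ι → Finset (V × Bool)) : Type _ :=
  {a // a ∈ closure c} ⊕ (TailIdx c × Bool)

/-- The index of the variable `Y a`. -/
def varY {c : ι → Finset (V × Bool)} (a : Finset (V × Bool)) (ha : a ∈ closure c) :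
    ι ⊕ ExtraIdx c :=
  Sum.inr (Sum.inl ⟨a, ha⟩)

theorem varY_injective {c : ι → Finset (V × Bool)} {a a' : Finset (V × Bool)}
    {ha : a ∈ closure c} {ha' : a' ∈ closure c} (h : varY a ha = varY a' ha') : a = a' :=
  congrArg Subtype.val (Sum.inl.inj (Sum.inr.inj h))

/-- The index of the variable `δ v A b`. -/
def varδ {c : ι → Finset (V × Bool)} (v : V) (b : Bool) :
    {A // A ∈ tails c v} ↪ ι ⊕ ExtraIdx c where
  toFun A := Sum.inr (Sum.inr (⟨v, A⟩, b))
  inj' A B h := by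
    have := Sum.inr.inj (Sum.inr.inj h)
    simpa using this

theorem varY_true_ne_varY_false {c : ι → Finset (V × Bool)} (t : TailIdx c) :
    varY _ (insert_mem_closure t.2.2 true) ≠ varY _ (insert_mem_closure t.2.2 false) := by
  intro h
  have h1 : (t.1, true) ∈ insert (t.1, false) t.2.1 :=
    varY_injective h ▸ Finset.mem_insert_self _ _
  rcases Finset.mem_insert.1 h1 with h2 | h2
  · simp at h2
  · exact ne_of_mem_tails t.2.2 _ h2 rfl

/-- The indices of the equations `coord`, `empty`, `marginal` and `decomp` of `IsFeasible`, in this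
order. -/
abbrev EqIdx (c : ι → Finset (V × Bool)) : Type _ :=
  ι ⊕ Unit ⊕ TailIdx c ⊕ (TailIdx c × Bool)

open Classical in
/-- The variables on the left-hand sides of the equations. -/
noncomputable def lhsVars (c : ι → Finset (V × Bool)) : EqIdx c → Finset (ι ⊕ ExtraIdx c)
  | .inl i => {Sum.inl i}
  | .inr (.inl _) => {varY ∅ (empty_mem_closure c)}
  | .inr (.inr (.inl t)) =>
    {varY _ (insert_mem_closure t.2.2 true), varY _ (insert_mem_closure t.2.2 false)}
  | .inr (.inr (.inr t)) => {varY _ (insert_mem_closure t.1.2.2 t.2)}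

/-- The variables on the right-hand sides of the equations. -/
def rhsVars {c : ι → Finset (V × Bool)} (hc : IsNested c) : EqIdx c → Finset (ι ⊕ ExtraIdx c)
  | .inl i => {varY _ (hc.mem_closure_self i)}
  | .inr (.inl _) => ∅
  | .inr (.inr (.inl t)) => {varY _ (hc.tails_subset_closure t.2.2)}
  | .inr (.inr (.inr t)) =>
    ((tails c t.1.1).attach.filter fun A => t.1.2.1 ⊆ A.1).map (varδ t.1.1 t.2)

/-- The constants on the right-hand sides of the equations. -/
def rhsConst (c : ι → Finset (V × Bool)) : EqIdx c → ℝ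
  | .inr (.inl _) => 1
  | _ => 0

theorem equations_iff_isFeasible {c : ι → Finset (V × Bool)} (hc : IsNested c) (z : ι → ℝ)
    (Y : Finset (V × Bool) → ℝ) (δ : V → Finset (V × Bool) → Bool → ℝ) (y : ExtraIdx c → ℝ)
    (hY : ∀ a, y (Sum.inl a) = Y a) (hδ : ∀ t, y (Sum.inr t) = δ t.1.1 t.1.2 t.2) :
    ((∀ e, ∑ u ∈ lhsVars c e, Sum.elim z y u =
        ∑ u ∈ rhsVars hc e, Sum.elim z y u + rhsConst c e) ∧ ∀ k, 0 ≤ y (Sum.inr k)) ↔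
      IsFeasible c z Y δ := by
  classical
  have hYv : ∀ a ha, Sum.elim z y (varY a ha) = Y a := fun a ha => hY ⟨a, ha⟩
  have hδv : ∀ v b A, Sum.elim z y (varδ v b A) = δ v A b := fun v b A => hδ (⟨v, A⟩, b)
  have hpair := fun t : TailIdx c => Finset.sum_pair (f := Sum.elim z y) (varY_true_ne_varY_false t)
  have hdec : ∀ (v : V) (B : Finset (V × Bool)) (b : Bool),
      ∑ A ∈ (tails c v).attach with B ⊆ A.1, δ v A b = ∑ A ∈ tails c v with B ⊆ A, δ v A b := by
    intro v B b
    rw [Finset.sum_filter, Finset.sum_filter,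
      ← Finset.sum_attach (tails c v) fun A => if B ⊆ A then δ v A b else 0]
  simp only [Sum.forall, Prod.forall, Sigma.forall, Subtype.forall, lhsVars, rhsVars, rhsConst,
    Finset.sum_singleton, Finset.sum_map, hpair, hYv, hδv, hδ, Sum.elim_inl, Finset.sum_empty,
    hdec, add_zero, zero_add, forall_const]
  exact ⟨fun h => ⟨h.1.1, h.1.2.1, h.1.2.2.1, h.1.2.2.2, h.2⟩,
    fun h => ⟨⟨h.coord, h.empty, h.marginal, h.decomp⟩, h.nonneg⟩⟩

/-- The set of expected values of a nested family of terms has an extended formulation whose size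
is linear in the total number of literals. -/
theorem IsNested.exists_extendedFormulation {c : ι → Finset (V × Bool)} (hc : IsNested c)
    {P : Set (ι → ℝ)} (hP : ∀ z, z ∈ P ↔
      ∃ w ∈ stdSimplex ℝ (V → Bool), ∀ i, z i = ∑ x, w x * value (c i) x) :
    ∃ F : ExtendedFormulation P,
      F.numVars ≤ Fintype.card ι + (1 + 4 * ∑ i, (c i).card) ∧
      F.numIneqs ≤ 2 * Fintype.card ι + 2 + 8 * ∑ i, (c i).card ∧
      F.IsZeroPlusMinusOne := by
  obtain ⟨F, h1, h2, h3⟩ := ExtendedFormulation.exists_of_sum_eq (P := P) (lhsVars c) (rhsVars hc)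
    (rhsConst c) (by rintro (_ | _ | _ | _) <;> simp [rhsConst])
    (fun t : TailIdx c × Bool => Sum.inr t) (fun z => by
      rw [hP]
      constructor
      · rintro ⟨w, hw, hz⟩
        obtain rfl : z = fun i => ∑ x, w x * value (c i) x := funext hz
        exact ⟨Sum.elim (fun a => _) fun t => _, (equations_iff_isFeasible hc _ _ _ _
          (fun _ => rfl) fun _ => rfl).2 (hc.isFeasible hw)⟩
      · rintro ⟨y, hy⟩
        exact hc.exists_distribution ((equations_iff_isFeasible hc z
          (fun a => if h : a ∈ closure c then y (Sum.inl ⟨a, h⟩) else 0)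
          (fun v A b => if h : A ∈ tails c v then y (Sum.inr (⟨v, A, h⟩, b)) else 0) y
          (fun a => by simp) fun t => by simp).1 hy))
  have hT : Fintype.card (TailIdx c) = ∑ v, (tails c v).card := by
    simp only [Fintype.card_sigma, Fintype.card_coe]
  have h4 := sum_card_tails_le c
  have h5 := card_closure_le c
  refine ⟨F, ?_, ?_, h3⟩
  · rw [h1]
    simp only [Fintype.card_sum, Fintype.card_prod, Fintype.card_coe, hT, Fintype.card_bool]
    omega
  · rw [h2]
    simp only [Fintype.card_sum, Fintype.card_prod, hT, Fintype.card_bool, Fintype.card_unit]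
    omega

end BooleanTerm

/-! ### Sequences of β-leaves -/

namespace Hypergraph

variable {α : Type*}

theorem IsBetaLeafSeq.mem_vertexSet {G : Hypergraph α} {l : List α} (h : G.IsBetaLeafSeq l) :
    ∀ v ∈ l, v ∈ G.vertexSet := by
  induction l generalizing G with
  | nil => simp
  | cons u l ih =>
    intro v hv
    rcases List.mem_cons.1 hv with rfl | hv
    · exact h.1.1
    · exact (ih h.2 v hv).1

theorem IsBetaLeafSeq.nodup {G : Hypergraph α} {l : List α} (h : G.IsBetaLeafSeq l) :
    l.Nodup := by
  induction l generalizing G with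
  | nil => simp
  | cons u l ih =>
    exact List.nodup_cons.2 ⟨fun hu => (IsBetaLeafSeq.mem_vertexSet h.2 u hu).2 rfl, ih h.2⟩

/-- In a sequence of β-leaves, the edges containing `v` are totally ordered by inclusion after
the nodes before `v` have been deleted. -/
theorem IsBetaLeafSeq.chain [DecidableEq α] {G : Hypergraph α} {l : List α}
    (h : G.IsBetaLeafSeq l) {v : α} (hv : v ∈ l) {e f : Set α} (he : e ∈ G.edgeSet)
    (hf : f ∈ G.edgeSet) (hve : v ∈ e) (hvf : v ∈ f) :
    (∀ x ∈ e, l.idxOf v ≤ l.idxOf x → x ∈ f) ∨ (∀ x ∈ f, l.idxOf v ≤ l.idxOf x → x ∈ e) := by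
  induction l generalizing G e f with
  | nil => simp at hv
  | cons u l ih =>
    by_cases huv : u = v
    · subst huv
      rcases h.1.2.total ⟨he, hve⟩ ⟨hf, hvf⟩ with hef | hfe
      · exact Or.inl fun x hx _ => hef hx
      · exact Or.inr fun x hx _ => hfe hx
    · have hvl : v ∈ l := (List.mem_cons.1 hv).resolve_left (Ne.symm huv)
      have hve' : v ∈ e \ {u} := ⟨hve, Ne.symm huv⟩
      have hvf' : v ∈ f \ {u} := ⟨hvf, Ne.symm huv⟩
      have hlt : ∀ x, (u :: l).idxOf v ≤ (u :: l).idxOf x → x ≠ u ∧ l.idxOf v ≤ l.idxOf x := by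
        intro x hx
        rw [List.idxOf_cons_ne _ huv] at hx
        have hxu : x ≠ u := by
          rintro rfl
          rw [List.idxOf_cons_self] at hx
          exact absurd hx (Nat.not_succ_le_zero _)
        rw [List.idxOf_cons_ne _ hxu.symm] at hx
        exact ⟨hxu, Nat.succ_le_succ_iff.1 hx⟩
      rcases ih h.2 hvl (e := e \ {u}) (f := f \ {u}) ⟨⟨v, hve'⟩, e, he, rfl⟩
        ⟨⟨v, hvf'⟩, f, hf, rfl⟩ hve' hvf' with H | H
      · exact Or.inl fun x hx hle => (H x ⟨hx, (hlt x hle).1⟩ (hlt x hle).2).1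
      · exact Or.inr fun x hx hle => (H x ⟨hx, (hlt x hle).1⟩ (hlt x hle).2).1

end Hypergraph

/-! ### The terms of a signed hypergraph -/

namespace SignedHypergraph

variable {V : Type*} (H : SignedHypergraph V)

/-- The term of an index of the pseudo-Boolean polytope: the single literal `v = 1` for a node `v`,
and the literals of its signed nodes for a signed edge. -/
def term : H.Idx → Finset (V × Bool)
  | .inl v => {(v, true)}
  | .inr s => s.1.edge.attach.map ⟨fun v => (v.1, decide (s.1.sign v = 1)),
      fun _ _ h => Subtype.ext (congrArg Prod.fst h)⟩

variable {H}

theorem mem_term_inr {s : {s : SignedEdge V // s ∈ H.edges}} {p : V × Bool} :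
    p ∈ H.term (Sum.inr s) ↔ ∃ h : p.1 ∈ s.1.edge, decide (s.1.sign ⟨p.1, h⟩ = 1) = p.2 := by
  simp only [term, Finset.mem_map, Finset.mem_attach, true_and]
  constructor
  · rintro ⟨v, rfl⟩
    exact ⟨v.2, rfl⟩
  · rintro ⟨h, hp⟩
    exact ⟨⟨p.1, h⟩, Prod.ext rfl hp⟩

theorem exists_mem_term_inr {s : {s : SignedEdge V // s ∈ H.edges}} {v : V} :
    (∃ b, (v, b) ∈ H.term (Sum.inr s)) ↔ v ∈ s.1.edge :=
  ⟨fun ⟨_, hb⟩ => (mem_term_inr.1 hb).1, fun h =>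
    ⟨decide (s.1.sign ⟨v, h⟩ = 1), mem_term_inr.2 ⟨h, rfl⟩⟩⟩

theorem injOn_term (i : H.Idx) : Set.InjOn Prod.fst (H.term i : Set (V × Bool)) := by
  rcases i with v | s
  · simp [term]
  · rintro ⟨u, b⟩ hp ⟨u', b'⟩ hq (rfl : u = u')
    obtain ⟨_, hp⟩ := mem_term_inr.1 hp
    obtain ⟨_, hq⟩ := mem_term_inr.1 hq
    exact Prod.ext rfl (hp.symm.trans hq)

theorem literal_eq (ε : ℤˣ) (b : Bool) :
    literal ε (if b = true then 1 else 0) = if b = decide (ε = 1) then 1 else 0 := by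
  unfold literal
  cases b <;> by_cases h : ε = 1 <;> simp [h]

/-- The pseudo-Boolean set consists of the values of the terms at the Boolean assignments. -/
theorem pseudoBooleanSet_eq_range :
    H.pseudoBooleanSet = Set.range fun (x : V → Bool) i => BooleanTerm.value (H.term i) x := by
  have hl : ∀ (v : V) (x : V → Bool),
      BooleanTerm.value (H.term (Sum.inl v)) x = if x v = true then 1 else 0 := fun v x => by
    simp [BooleanTerm.value, term]
  have hr : ∀ (s : {s : SignedEdge V // s ∈ H.edges}) (x : V → Bool),
      BooleanTerm.value (H.term (Sum.inr s)) x =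
        ∏ v : s.1.edge, literal (s.1.sign v) (if x v.1 = true then 1 else 0) := fun s x => by
    simp only [BooleanTerm.value, term, Finset.prod_map, literal_eq]
    rfl
  ext z
  constructor
  · rintro ⟨h01, hz⟩
    have hx : ∀ v, z (Sum.inl v) = if decide (z (Sum.inl v) = 1) = true then 1 else 0 := by
      intro v
      rcases h01 (Sum.inl v) with h | h <;> simp [h]
    refine ⟨fun v => decide (z (Sum.inl v) = 1), funext fun i => ?_⟩
    rcases i with v | s
    · exact (hl v _).trans (hx v).symm
    · refine (hr s _).trans ((hz s).trans ?_).symm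
      exact Finset.prod_congr rfl fun v _ => congrArg _ (hx v.1)
  · rintro ⟨x, rfl⟩
    refine ⟨fun i => ?_, fun s => ?_⟩
    · by_cases h : BooleanTerm.Sat x (H.term i)
      · exact Or.inr (BooleanTerm.value_of_sat h)
      · exact Or.inl (BooleanTerm.value_of_not_sat h)
    · simp only [hl]
      exact hr s x

/-- The points of the pseudo-Boolean polytope are the expected values of the terms under the
distributions on the Boolean assignments. -/
theorem mem_pseudoBooleanPolytope [Fintype V] [DecidableEq V] {z : H.Idx → ℝ} :
    z ∈ H.pseudoBooleanPolytope ↔ ∃ w ∈ stdSimplex ℝ (V → Bool),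
      ∀ i, z i = ∑ x, w x * BooleanTerm.value (H.term i) x := by
  let L : ((V → Bool) → ℝ) →ₗ[ℝ] (H.Idx → ℝ) :=
    LinearMap.pi fun i => ∑ x, BooleanTerm.value (H.term i) x • LinearMap.proj x
  have hL : ∀ w i, L w i = ∑ x, w x * BooleanTerm.value (H.term i) x := fun w i => by
    simp [L, mul_comm]
  have : H.pseudoBooleanPolytope = L '' stdSimplex ℝ (V → Bool) := by
    rw [← convexHull_rangle_single_eq_stdSimplex, LinearMap.image_convexHull, ← Set.range_comp,
      pseudoBooleanPolytope, pseudoBooleanSet_eq_range]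
    congr 2
    ext x i
    simp [hL, Pi.single_apply]
  rw [this]
  exact exists_congr fun w => and_congr Iff.rfl
    ⟨fun h i => by rw [← h, hL], fun h => funext fun i => by rw [h, hL]⟩

/-- Along a linear order of the nodes that realizes β-acyclicity, the terms are nested. The tail of
the term of a node is empty, so node terms do not disturb the chains. -/
theorem isNested_term [LinearOrder V] (h : ∀ v : V, ∀ s ∈ H.edges, ∀ t ∈ H.edges,
      v ∈ s.edge → v ∈ t.edge →
      (∀ x ∈ s.edge, v < x → x ∈ t.edge) ∨ (∀ x ∈ t.edge, v < x → x ∈ s.edge)) :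
    BooleanTerm.IsNested H.term where
  injOn := injOn_term
  chain := by
    have hnode : ∀ v u : V, (∃ b, (v, b) ∈ H.term (Sum.inl u)) →
        ∀ p ∈ H.term (Sum.inl u), ¬ v < p.1 := by
      rintro v u ⟨b, hb⟩ p hp
      obtain ⟨rfl, -⟩ := Prod.mk.inj (Finset.mem_singleton.1 hb)
      rw [Finset.mem_singleton.1 hp]
      exact lt_irrefl _
    rintro v (u | s) j hi hj
    · exact Or.inl fun p hp hlt => absurd hlt (hnode v u hi p hp)
    rcases j with u | t
    · exact Or.inr fun p hp hlt => absurd hlt (hnode v u hj p hp)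
    rcases h v s.1 s.2 t.1 t.2 (exists_mem_term_inr.1 hi) (exists_mem_term_inr.1 hj) with h | h
    · exact Or.inl fun p hp hlt =>
        exists_mem_term_inr.2 (h _ (exists_mem_term_inr.1 ⟨p.2, hp⟩) hlt)
    · exact Or.inr fun p hp hlt =>
        exists_mem_term_inr.2 (h _ (exists_mem_term_inr.1 ⟨p.2, hp⟩) hlt)

theorem sum_card_term_le [Fintype V] :
    ∑ i, (H.term i).card ≤ Fintype.card V + H.edges.card * H.rank := by
  rw [Fintype.sum_sum_type]
  refine add_le_add (le_of_eq (by simp [term])) ?_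
  refine (Finset.sum_le_card_nsmul Finset.univ _ H.rank fun s _ => ?_).trans_eq (by simp)
  have : (H.term (Sum.inr s)).card = s.1.edge.card := by simp [term]
  rw [this]
  exact Finset.le_sup (f := fun s : SignedEdge V => s.edge.card) s.2

end SignedHypergraph

/-! ### The extended formulation of the pseudo-Boolean polytope -/

theorem mainTheorem1 {V : Type*} [Fintype V] (H : SignedHypergraph V)
    (hS : H.edges.Nonempty) (hacyc : H.underlying.IsBetaAcyclic) :
    ∃ F : ExtendedFormulation H.pseudoBooleanPolytope,
      F.numVars ≤ 2 * H.rank * (2 * H.edges.card + 1) * Fintype.card V ∧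
      F.numIneqs ≤ 4 * H.rank * (2 * H.edges.card + 1) * Fintype.card V ∧
      F.IsZeroPlusMinusOne := by
  classical
  obtain ⟨l, hl, hlen⟩ := hacyc
  have hmem : ∀ v, v ∈ l := by
    have hcard : l.toFinset.card = Fintype.card V := by
      rw [List.toFinset_card_of_nodup hl.nodup, hlen, ← Nat.card_eq_fintype_card]
      exact Set.ncard_univ V
    intro v
    rw [← List.mem_toFinset, Finset.eq_univ_of_card _ hcard]
    exact Finset.mem_univ v
  have hchain : ∀ v : V, ∀ s ∈ H.edges, ∀ t ∈ H.edges, v ∈ s.edge → v ∈ t.edge →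
      (∀ x ∈ s.edge, l.idxOf v ≤ l.idxOf x → x ∈ t.edge) ∨
        (∀ x ∈ t.edge, l.idxOf v ≤ l.idxOf x → x ∈ s.edge) := fun v s hs t ht hvs hvt =>
    hl.chain (hmem v) ⟨s, hs, rfl⟩ ⟨t, ht, rfl⟩ hvs hvt
  let _ : LinearOrder V := LinearOrder.lift' l.idxOf fun u v huv => (List.idxOf_inj (hmem u)).1 huv
  have hnest : BooleanTerm.IsNested H.term := by
    refine SignedHypergraph.isNested_term fun v s hs t ht hvs hvt => ?_
    exact (hchain v s hs t ht hvs hvt).imp (fun h x hx hlt => h x hx hlt.le)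
      fun h x hx hlt => h x hx hlt.le
  obtain ⟨F, hvars, hineqs, hF⟩ := hnest.exists_extendedFormulation
    (P := H.pseudoBooleanPolytope) fun z => SignedHypergraph.mem_pseudoBooleanPolytope
  obtain ⟨s, hs⟩ := hS
  have hS1 : 1 ≤ H.edges.card := Finset.card_pos.2 ⟨s, hs⟩
  have hr : 2 ≤ H.rank := s.two_le_card.trans
    (Finset.le_sup (f := fun s : SignedEdge V => s.edge.card) hs)
  have hn : 2 ≤ Fintype.card V := s.two_le_card.trans (Finset.card_le_univ _)
  have hι : Fintype.card H.Idx = Fintype.card V + H.edges.card := by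
    rw [Fintype.card_sum, Fintype.card_coe]
  have hsum := SignedHypergraph.sum_card_term_le (H := H)
  rw [hι] at hvars hineqs
  generalize H.edges.card = m at *
  generalize H.rank = r at *
  generalize Fintype.card V = n at *
  -- With `r, n ≥ 2` and `m ≥ 1`, the bounds `n + m + 1 + 4 (n + m r)` and
  -- `2 (n + m) + 2 + 8 (n + m r)` are below the claimed ones.
  have hrn : 2 * n ≤ r * n := Nat.mul_le_mul_right n hr
  have hmr : m * r * 2 ≤ m * r * n := Nat.mul_le_mul_left (m * r) hn
  have hmn : m * 2 * n ≤ m * r * n := Nat.mul_le_mul_right n (Nat.mul_le_mul_left m hr)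
  have hn1 : 1 * n ≤ m * n := Nat.mul_le_mul_right n hS1
  have hm2 : m * 2 ≤ m * n := Nat.mul_le_mul_left m hn
  refine ⟨F, hvars.trans ?_, hineqs.trans ?_, hF⟩ <;> nlinarith
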